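/- **Setting.** Let $m_1,m_2\in\mathbb N_0$, $m=m_1+m_2>0$, $j=\mathrm{diag}\{I_{m_1},-I_{m_2}\}$, let $c_1,\dots,c_r\in\mathbb R$ be pairwise distinct, let $\mathcal I\subseteq\mathbb R$ be an interval with $0\in\mathcal I$, and let $\beta_k:\mathcal I\to\mathbb C^{p\times m}$ $(1\le k\le r,\ p\le m)$ be such that the Hamiltonians $H_k=\beta_k^*\beta_k$ are locally summable on $\mathcal I$. Consider the generalised Hamiltonian system $$y'(x,z)=G(x,z)y(x,z),\qquad G(x,z)=\mathrm i\sum_{k=1}^r (z-c_k)^{-1}j\beta_k(x)^*\beta_k(x),\qquad x\in\mathcal I .$$ Differential equations are understood almost everywhere, for locally absolutely continuous functions. Let $n\in\mathbb N$, $A,S(0)\in\mathbb C^{n\times n}$, $\Pi(0)\in\mathbb C^{n\times m}$ satisfy $$AS(0)-S(0)A^*=\mathrm i\,\Pi(0)j\Pi(0)^*,\qquad S(0)=S(0)^*,\qquad c_k\notin\sigma(A)\quad(1\le k\le r).$$ **Theorem.** The equations $$\Pi'=-\mathrm i\sum_{k=1}^r(A-c_kI_n)^{-1}\Pi jH_k,\qquad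 S'=-\sum_{k=1}^r(A-c_kI_n)^{-1}\Pi jH_kj\Pi^*(A^*-c_kI_n)^{-1}$$ with the given values $\Pi(0),S(0)$ have a unique solution $(\Pi,S)$ on $\mathcal I$. Put $$w_A(x,z)=I_m-\mathrm i\,j\Pi(x)^*S(x)^{-1}(A-zI_n)^{-1}\Pi(x),$$ and let the GBDT-transformed system be $\widetilde y'=\widetilde G\widetilde y$ with $\widetilde G(x,z)=-\sum_{k=1}^r(z-c_k)^{-1}\widetilde q_k(x)$, where, for $q_k=-\mathrm i jH_k$, $$\widetilde q_k=q_k+q_kY_k-X_kq_k-X_kq_kY_k,$$ $$X_k=\mathrm i j\Pi^*S^{-1}(A-c_kI_n)^{-1}\Pi,\qquad Y_k=\mathrm i j\Pi^*(A^*-c_kI_n)^{-1}S^{-1}\Pi .$$ Let $\mathcal J\subseteq\mathcal I$ be any subinterval on which $S(x)$ is invertible (for instance $\mathcal J=\mathcal I$ if $S$ is invertible on $\mathcal I$). Then: 1. On $\mathcal J$ the transformed system has the same form as the initial one: $\widetilde q_k=-\mathrm i j\widetilde H_k$, that is, $$\widetilde G(x,z)=\mathrm i\sum_{k=1}^r(z-c_k)^{-1}j\widetilde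 H_k(x),\qquad \widetilde H_k=\widetilde\beta_k^*\widetilde\beta_k,\qquad \widetilde\beta_k(x)=\beta_k(x)\,j\,w_A(x,c_k)^*\,j,$$ and the $\widetilde H_k$ are locally summable on $\mathcal J$. 2. For every $z\in\mathbb C\setminus(\sigma(A)\cup\{c_1,\dots,c_r\})$ the function $w_A(\cdot,z)$ satisfies $$w_A'(x,z)=\widetilde G(x,z)w_A(x,z)-w_A(x,z)G(x,z)$$ on $\mathcal J$, and $w_Aw$ is a matrix solution of the transformed system on $\mathcal J$ whenever $w$ is an $m\times m$ matrix solution of the initial one. 3. If, in addition, $z\notin\sigma(A^*)$, then $w_A(x,z)$ is invertible for all $x\in\mathcal J$, so that $w_A$ is a Darboux matrix, and for every fundamental (that is, invertible $m\times m$ matrix) solution $w(x,z)$ of the initial system on $\mathcal J$ the function $$\widetilde w(x,z)=w_A(x,z)w(x,z)$$ is a fundamental solution of the transformed system on $\mathcal J$. -/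

import Mathlib

/-!
The identity `A S - S A^* = i Π j Π^*` propagates from `0` to the whole interval, because both
sides have the same Carathéodory derivative. So `w_A` is the transfer matrix function of a
symmetric S-node, and `q̃ₖ = w_A(x, cₖ) qₖ j w_A(x, cₖ)^* j` with
`j w_A(x, cₖ)^* j w_A(x, z) = I + O(z - cₖ)`. Together with the resolvent identity this makes
`q̃ₖ w_A - w_A qₖ` divisible by `z - cₖ`, so the poles of `G̃ w_A - w_A G` at the `cₖ` cancel, and
what is left is the derivative of `w_A`. Existence and uniqueness of `Π` come from the Peano–Baker
series of a linear equation with locally integrable coefficients; `S` is then a primitive.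
-/

open scoped Matrix

noncomputable section

namespace GBDT

/-- A matrix function on the real line is locally summable on `J` when all its entries are. -/
def LocSummableOn {ι κ : Type} (J : Set ℝ) (F : ℝ → Matrix ι κ ℂ) : Prop :=
  ∀ i l, MeasureTheory.LocallyIntegrableOn (fun x => F x i l) J

/-- `Y' = F` on the interval `J` in the sense of Carathéodory: every entry of `Y` is absolutely
continuous on each compact subinterval of `J`, and the derivative of `Y` equals `F` almost
everywhere on `J`. -/
structure HasAEDerivOn {ι κ : Type} (J : Set ℝ) (Y F : ℝ → Matrix ι κ ℂ) : Prop where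
  ac : ∀ i l, ∀ a ∈ J, ∀ b ∈ J, AbsolutelyContinuousOnInterval (fun x => Y x i l) a b
  deriv : ∀ᵐ x : ℝ, x ∈ J → ∀ i l, HasDerivAt (fun t => Y t i l) (F x i l) x

/-- The matrix function `W` satisfies `W' = G̃ W - W G` on `J`. -/
def SolvesDarbouxEq {ι : Type} [Fintype ι] (J : Set ℝ) (G G' W : ℝ → Matrix ι ι ℂ) : Prop :=
  HasAEDerivOn J W (fun x => G' x * W x - W x * G x)

/-- `W` is a Darboux matrix on `J` for the pair of systems `y' = G y` and `y' = G̃ y`: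
a nondegenerate solution of `W' = G̃ W - W G`. -/
structure IsDarbouxMatrix {ι : Type} [Fintype ι] [DecidableEq ι] (J : Set ℝ)
    (G G' W : ℝ → Matrix ι ι ℂ) : Prop where
  eqn : SolvesDarbouxEq J G G' W
  nondegenerate : ∀ x ∈ J, IsUnit (W x)

/-- `w` is a (square) matrix solution of `y' = G y` on `J`. -/
def IsMatrixSolution {ι : Type} [Fintype ι] (J : Set ℝ) (G w : ℝ → Matrix ι ι ℂ) : Prop :=
  HasAEDerivOn J w (fun x => G x * w x)

/-- `w` is a fundamental solution of `y' = G y` on `J`: an invertible matrix solution. -/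
structure IsFundamentalSolution {ι : Type} [Fintype ι] [DecidableEq ι] (J : Set ℝ)
    (G w : ℝ → Matrix ι ι ℂ) : Prop where
  solution : IsMatrixSolution J G w
  invertible : ∀ x ∈ J, IsUnit (w x)

/-- The signature matrix `j = diag(I_{m₁}, -I_{m₂})`. -/
def sig (m₁ m₂ : ℕ) : Matrix (Fin m₁ ⊕ Fin m₂) (Fin m₁ ⊕ Fin m₂) ℂ :=
  Matrix.fromBlocks 1 0 0 (-1)

variable {r m₁ m₂ p n : ℕ}

/-- The coefficient `i ∑ₖ (z - cₖ)⁻¹ j βₖ(x)^* βₖ(x)` of the generalised Hamiltonian system. -/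
def hamCoeff (c : Fin r → ℝ) (β : Fin r → ℝ → Matrix (Fin p) (Fin m₁ ⊕ Fin m₂) ℂ)
    (z : ℂ) (x : ℝ) : Matrix (Fin m₁ ⊕ Fin m₂) (Fin m₁ ⊕ Fin m₂) ℂ :=
  Complex.I • ∑ k, (z - (c k : ℂ))⁻¹ • (sig m₁ m₂ * ((β k x)ᴴ * β k x))

/-- The resolvent-type factor `(A - z I_n)⁻¹`. -/
def res (A : Matrix (Fin n) (Fin n) ℂ) (z : ℂ) : Matrix (Fin n) (Fin n) ℂ :=
  (A - z • (1 : Matrix (Fin n) (Fin n) ℂ))⁻¹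

/-- The matrix functions `Π` and `S` on the interval `I` determined by the triple
`{A, S(0), Π(0)} = {A, S₀, Π₀}`:
`Π' = -i ∑ₖ (A - cₖ)⁻¹ Π j Hₖ` and `S' = -∑ₖ (A - cₖ)⁻¹ Π j Hₖ j Π^* (A^* - cₖ)⁻¹`,
where `Hₖ = βₖ^* βₖ`. -/
structure IsNodeFlow (I : Set ℝ) (c : Fin r → ℝ)
    (β : Fin r → ℝ → Matrix (Fin p) (Fin m₁ ⊕ Fin m₂) ℂ)
    (A S₀ : Matrix (Fin n) (Fin n) ℂ) (P₀ : Matrix (Fin n) (Fin m₁ ⊕ Fin m₂) ℂ)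
    (P : ℝ → Matrix (Fin n) (Fin m₁ ⊕ Fin m₂) ℂ) (S : ℝ → Matrix (Fin n) (Fin n) ℂ) : Prop where
  P_zero : P 0 = P₀
  S_zero : S 0 = S₀
  P_eqn : HasAEDerivOn I P (fun x =>
    (-Complex.I) • ∑ k, res A (c k) * P x * sig m₁ m₂ * ((β k x)ᴴ * β k x))
  S_eqn : HasAEDerivOn I S (fun x =>
    -∑ k, res A (c k) * P x * sig m₁ m₂ * ((β k x)ᴴ * β k x) * sig m₁ m₂ * (P x)ᴴ
      * res Aᴴ (c k))

/-- The transfer matrix function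
`w_A(x, z) = I_m - i j Π(x)^* S(x)⁻¹ (A - z I_n)⁻¹ Π(x)`. -/
def transfer (A : Matrix (Fin n) (Fin n) ℂ) (P : ℝ → Matrix (Fin n) (Fin m₁ ⊕ Fin m₂) ℂ)
    (S : ℝ → Matrix (Fin n) (Fin n) ℂ) (z : ℂ) (x : ℝ) :
    Matrix (Fin m₁ ⊕ Fin m₂) (Fin m₁ ⊕ Fin m₂) ℂ :=
  1 - Complex.I • (sig m₁ m₂ * (P x)ᴴ * (S x)⁻¹ * res A z * P x)

/-- The transformed coefficient `q̃ = q + q Y - X q - X q Y` of a simple pole `(z - c)⁻¹` under the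
generalised Bäcklund-Darboux transformation determined by an S-node
`A₁ S - S A₂ = Π₁ Π₂^*` (the argument `P₂s` is `Π₂^*`), where
`X = Π₂^* S⁻¹ (A₁ - c)⁻¹ Π₁` and `Y = Π₂^* (A₂ - c)⁻¹ S⁻¹ Π₁`. -/
def nodeCoeff {ι : Type} [Fintype ι] (A₁ A₂ S : Matrix (Fin n) (Fin n) ℂ)
    (P₁ : Matrix (Fin n) ι ℂ) (P₂s : Matrix ι (Fin n) ℂ) (c : ℂ) (q : Matrix ι ι ℂ) :
    Matrix ι ι ℂ :=
  let X := P₂s * S⁻¹ * res A₁ c * P₁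
  let Y := P₂s * res A₂ c * S⁻¹ * P₁
  q + q * Y - X * q - X * q * Y

/-- The coefficient `q̃ₖ(x)` of the GBDT-transformed system. The initial generalised Hamiltonian
system is `y' = -(∑ₖ (z - cₖ)⁻¹ qₖ) y` with `qₖ = -i j Hₖ`, and the S-node is the symmetric one:
`A₁ = A`, `A₂ = A^*`, `Π₁ = Π`, `Π₂^* = i j Π^*`. -/
def gbdtCoeff (c : Fin r → ℝ) (β : Fin r → ℝ → Matrix (Fin p) (Fin m₁ ⊕ Fin m₂) ℂ)
    (A : Matrix (Fin n) (Fin n) ℂ) (P : ℝ → Matrix (Fin n) (Fin m₁ ⊕ Fin m₂) ℂ)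
    (S : ℝ → Matrix (Fin n) (Fin n) ℂ) (k : Fin r) (x : ℝ) :
    Matrix (Fin m₁ ⊕ Fin m₂) (Fin m₁ ⊕ Fin m₂) ℂ :=
  nodeCoeff A Aᴴ (S x) (P x) (Complex.I • (sig m₁ m₂ * (P x)ᴴ)) (c k)
    ((-Complex.I) • (sig m₁ m₂ * ((β k x)ᴴ * β k x)))

/-- The coefficient `G̃(x, z) = -∑ₖ (z - cₖ)⁻¹ q̃ₖ(x)` of the GBDT-transformed system. -/
def gbdtSystem (c : Fin r → ℝ) (β : Fin r → ℝ → Matrix (Fin p) (Fin m₁ ⊕ Fin m₂) ℂ)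
    (A : Matrix (Fin n) (Fin n) ℂ) (P : ℝ → Matrix (Fin n) (Fin m₁ ⊕ Fin m₂) ℂ)
    (S : ℝ → Matrix (Fin n) (Fin n) ℂ) (z : ℂ) (x : ℝ) :
    Matrix (Fin m₁ ⊕ Fin m₂) (Fin m₁ ⊕ Fin m₂) ℂ :=
  -∑ k, (z - (c k : ℂ))⁻¹ • gbdtCoeff c β A P S k x

/-- The transformed factors `β̃ₖ(x) = βₖ(x) j w_A(x, cₖ)^* j`. -/
def betaT (c : Fin r → ℝ) (β : Fin r → ℝ → Matrix (Fin p) (Fin m₁ ⊕ Fin m₂) ℂ)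
    (A : Matrix (Fin n) (Fin n) ℂ) (P : ℝ → Matrix (Fin n) (Fin m₁ ⊕ Fin m₂) ℂ)
    (S : ℝ → Matrix (Fin n) (Fin n) ℂ) (k : Fin r) (x : ℝ) :
    Matrix (Fin p) (Fin m₁ ⊕ Fin m₂) ℂ :=
  β k x * sig m₁ m₂ * (transfer A P S (c k) x)ᴴ * sig m₁ m₂

end GBDT

end

noncomputable section

namespace GBDT

open MeasureTheory Set Filter Topology Interval

section AbsolutelyContinuous

variable {X Y Z : Type*} [PseudoMetricSpace X] [PseudoMetricSpace Y] [PseudoMetricSpace Z]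
  {a b : ℝ}

theorem absolutelyContinuousOnInterval_of_dist_le_add {f : ℝ → X} {g : ℝ → Y} {h : ℝ → Z}
    (K L : ℝ) (hg : AbsolutelyContinuousOnInterval g a b)
    (hh : AbsolutelyContinuousOnInterval h a b)
    (hle : ∀ u ∈ uIcc a b, ∀ v ∈ uIcc a b,
      dist (f u) (f v) ≤ K * dist (g u) (g v) + L * dist (h u) (h v)) :
    AbsolutelyContinuousOnInterval f a b := by
  unfold AbsolutelyContinuousOnInterval at hg hh ⊢
  have hlim := (hg.const_mul K).add (hh.const_mul L)
  simp only [mul_zero, add_zero] at hlim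
  refine squeeze_zero' (Eventually.of_forall fun E => Finset.sum_nonneg fun i _ => dist_nonneg)
    (mem_inf_of_right <| mem_principal.2 fun E hE => ?_) hlim
  rw [mem_ofPred_eq, Finset.mul_sum, Finset.mul_sum, ← Finset.sum_add_distrib]
  exact Finset.sum_le_sum fun i hi => hle _ (hE.1 i hi).1 _ (hE.1 i hi).2

theorem absolutelyContinuousOnInterval_of_dist_le {f : ℝ → X} {g : ℝ → Y} (K : ℝ)
    (hg : AbsolutelyContinuousOnInterval g a b)
    (hle : ∀ u ∈ uIcc a b, ∀ v ∈ uIcc a b, dist (f u) (f v) ≤ K * dist (g u) (g v)) :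
    AbsolutelyContinuousOnInterval f a b :=
  absolutelyContinuousOnInterval_of_dist_le_add K 0 hg hg (by simpa using hle)

theorem absolutelyContinuousOnInterval_const (x : X) (a b : ℝ) :
    AbsolutelyContinuousOnInterval (fun _ => x) a b := by
  simpa [AbsolutelyContinuousOnInterval] using tendsto_const_nhds

end AbsolutelyContinuous

section Interval

variable {J : Set ℝ}

theorem exists_uIcc_mem_nhdsWithin {x : ℝ} (hx : x ∈ J) :
    ∃ a ∈ J, ∃ b ∈ J, x ∈ uIcc a b ∧ uIcc a b ∈ 𝓝[J] x := by
  have hleft : ∃ a ∈ J, a ≤ x ∧ Ici a ∈ 𝓝[J] x := by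
    by_cases! h : ∃ a ∈ J, a < x
    · obtain ⟨a, ha, hax⟩ := h
      exact ⟨a, ha, hax.le, mem_nhdsWithin_of_mem_nhds (Ici_mem_nhds hax)⟩
    · exact ⟨x, hx, le_rfl, mem_of_superset self_mem_nhdsWithin h⟩
  have hright : ∃ b ∈ J, x ≤ b ∧ Iic b ∈ 𝓝[J] x := by
    by_cases! h : ∃ b ∈ J, x < b
    · obtain ⟨b, hb, hxb⟩ := h
      exact ⟨b, hb, hxb.le, mem_nhdsWithin_of_mem_nhds (Iic_mem_nhds hxb)⟩
    · exact ⟨x, hx, le_rfl, mem_of_superset self_mem_nhdsWithin h⟩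
  obtain ⟨a, ha, hax, hleft⟩ := hleft
  obtain ⟨b, hb, hxb, hright⟩ := hright
  refine ⟨a, ha, b, hb, ?_⟩
  rw [uIcc_of_le (hax.trans hxb), ← Ici_inter_Iic]
  exact ⟨⟨hax, hxb⟩, inter_mem hleft hright⟩

theorem continuousOn_of_uIcc {X : Type*} [TopologicalSpace X] {f : ℝ → X}
    (hf : ∀ a ∈ J, ∀ b ∈ J, ContinuousOn f (uIcc a b)) : ContinuousOn f J := by
  intro x hx
  obtain ⟨a, ha, b, hb, hxab, hn⟩ := exists_uIcc_mem_nhdsWithin hx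
  exact (hf a ha b hb x hxab).mono_of_mem_nhdsWithin hn

variable {E : Type*} [NormedAddCommGroup E] {f : ℝ → E}

theorem locallyIntegrableOn_iff_intervalIntegrable (hJ : J.OrdConnected) :
    LocallyIntegrableOn f J ↔ ∀ a ∈ J, ∀ b ∈ J, IntervalIntegrable f volume a b := by
  refine ⟨fun h a ha b hb => (h.integrableOn_compact_subset (hJ.uIcc_subset ha hb)
    isCompact_uIcc).intervalIntegrable, fun h x hx => ?_⟩
  obtain ⟨a, ha, b, hb, -, hn⟩ := exists_uIcc_mem_nhdsWithin hx
  exact ⟨_, hn, intervalIntegrable_iff' (by simp) |>.1 (h a ha b hb)⟩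

theorem ae_hasDerivAt_intervalIntegral [NormedSpace ℝ E] [CompleteSpace E] {a : ℝ} (ha : a ∈ J)
    (hf : ∀ b ∈ J, ∀ c ∈ J, IntervalIntegrable f volume b c) :
    ∀ᵐ x, x ∈ J → HasDerivAt (fun x => ∫ t in a..x, f t) (f x) x := by
  refine ae_of_mem_of_ae_of_mem_inter_Ioo fun b c hb hc _ => ?_
  filter_upwards [(hf b hb c hc).ae_hasDerivAt_integral] with x hx hxJ
  have hIoo : Ioo b c ⊆ uIcc b c := Ioo_subset_Icc_self.trans Icc_subset_uIcc
  refine ((hx (hIoo hxJ.2) b left_mem_uIcc).const_add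
    (∫ t in a..b, f t)).congr_of_eventuallyEq ?_
  filter_upwards [Ioo_mem_nhds hxJ.2.1 hxJ.2.2] with y hy
  exact (intervalIntegral.integral_add_adjacent_intervals (hf a ha b hb)
    ((hf b hb c hc).mono_set (uIcc_subset_uIcc_left (hIoo hy)))).symm

section Bilinear

variable {F G : Type*} [NormedAddCommGroup F] [NormedAddCommGroup G] [NormedSpace ℝ E]
  [NormedSpace ℝ F] [NormedSpace ℝ G] {g : ℝ → F}

theorem intervalIntegrable_bilin_apply (B : E →L[ℝ] F →L[ℝ] G) {a b : ℝ}
    (hf : IntervalIntegrable f volume a b) (hg : ContinuousOn g (uIcc a b)) :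
    IntervalIntegrable (fun x => B (f x) (g x)) volume a b := by
  obtain ⟨C, hC⟩ := isCompact_uIcc.exists_bound_of_continuousOn hg
  rw [intervalIntegrable_iff] at hf ⊢
  exact B.integrable_of_bilin_of_bdd_right C hf
    ((hg.mono uIoc_subset_uIcc).aestronglyMeasurable measurableSet_uIoc)
    ((ae_restrict_iff' measurableSet_uIoc).2
      (Eventually.of_forall fun x hx => hC x (uIoc_subset_uIcc hx)))

theorem locallyIntegrableOn_bilin_apply (hJ : J.OrdConnected) (B : E →L[ℝ] F →L[ℝ] G)
    (hf : LocallyIntegrableOn f J) (hg : ContinuousOn g J) :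
    LocallyIntegrableOn (fun x => B (f x) (g x)) J := by
  rw [locallyIntegrableOn_iff_intervalIntegrable hJ] at hf ⊢
  exact fun a ha b hb =>
    intervalIntegrable_bilin_apply B (hf a ha b hb) (hg.mono (hJ.uIcc_subset ha hb))

end Bilinear

end Interval

section CaratheodoryDeriv

variable {E F G : Type*} [NormedAddCommGroup E] [NormedSpace ℝ E] [NormedAddCommGroup F]
  [NormedSpace ℝ F] [NormedAddCommGroup G] [NormedSpace ℝ G]

/-- `y' = f` on `J` in the sense of Carathéodory, for functions with values in a normed space.
For matrix-valued functions this is `HasAEDerivOn`, see `hasAEDerivOn_iff`. -/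
structure HasCaratheodoryDerivOn (J : Set ℝ) (y f : ℝ → E) : Prop where
  ac : ∀ a ∈ J, ∀ b ∈ J, AbsolutelyContinuousOnInterval y a b
  deriv : ∀ᵐ x : ℝ, x ∈ J → HasDerivAt y (f x) x

namespace HasCaratheodoryDerivOn

variable {J : Set ℝ} {y f : ℝ → E}

theorem continuousOn (h : HasCaratheodoryDerivOn J y f) : ContinuousOn y J :=
  continuousOn_of_uIcc fun a ha b hb => (h.ac a ha b hb).continuousOn

theorem congr_deriv {g : ℝ → E} (h : HasCaratheodoryDerivOn J y f) (hfg : EqOn f g J) :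
    HasCaratheodoryDerivOn J y g where
  ac := h.ac
  deriv := h.deriv.mono fun _ hx hxJ => hfg hxJ ▸ hx hxJ

protected theorem const (J : Set ℝ) (v : E) :
    HasCaratheodoryDerivOn J (fun _ => v) (fun _ => 0) where
  ac a _ b _ := absolutelyContinuousOnInterval_const v a b
  deriv := Eventually.of_forall fun _ _ => hasDerivAt_const _ _

theorem add {z g : ℝ → E} (hy : HasCaratheodoryDerivOn J y f)
    (hz : HasCaratheodoryDerivOn J z g) :
    HasCaratheodoryDerivOn J (fun x => y x + z x) (fun x => f x + g x) where
  ac a ha b hb := (hy.ac a ha b hb).add (hz.ac a ha b hb)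
  deriv := by
    filter_upwards [hy.deriv, hz.deriv] with x hy hz hx using (hy hx).add (hz hx)

theorem sub {z g : ℝ → E} (hy : HasCaratheodoryDerivOn J y f)
    (hz : HasCaratheodoryDerivOn J z g) :
    HasCaratheodoryDerivOn J (fun x => y x - z x) (fun x => f x - g x) where
  ac a ha b hb := (hy.ac a ha b hb).sub (hz.ac a ha b hb)
  deriv := by
    filter_upwards [hy.deriv, hz.deriv] with x hy hz hx using (hy hx).sub (hz hx)

theorem sum {α : Type*} (s : Finset α) {y f : α → ℝ → E}
    (h : ∀ k ∈ s, HasCaratheodoryDerivOn J (y k) (f k)) :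
    HasCaratheodoryDerivOn J (fun x => ∑ k ∈ s, y k x) (fun x => ∑ k ∈ s, f k x) := by
  classical
  induction s using Finset.induction_on with
  | empty => simpa using HasCaratheodoryDerivOn.const J (0 : E)
  | insert k s hk ih =>
    simp only [Finset.sum_insert hk]
    exact (h k (s.mem_insert_self k)).add (ih fun l hl => h l (Finset.mem_insert_of_mem hl))

theorem clm_apply (T : E →L[ℝ] F) (h : HasCaratheodoryDerivOn J y f) :
    HasCaratheodoryDerivOn J (fun x => T (y x)) (fun x => T (f x)) where
  ac a ha b hb := absolutelyContinuousOnInterval_of_dist_le ‖T‖ (h.ac a ha b hb)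
    fun _ _ _ _ => T.dist_le_opNorm _ _
  deriv := h.deriv.mono fun x hx hxJ => T.hasFDerivAt.comp_hasDerivAt x (hx hxJ)

theorem bilin_apply (B : E →L[ℝ] F →L[ℝ] G) {z g : ℝ → F} (hy : HasCaratheodoryDerivOn J y f)
    (hz : HasCaratheodoryDerivOn J z g) :
    HasCaratheodoryDerivOn J (fun x => B (y x) (z x)) (fun x => B (y x) (g x) + B (f x) (z x)) where
  ac a ha b hb := by
    obtain ⟨K, hK⟩ := (hy.ac a ha b hb).exists_bound
    obtain ⟨L, hL⟩ := (hz.ac a ha b hb).exists_bound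
    refine absolutelyContinuousOnInterval_of_dist_le_add (‖B‖ * L) (‖B‖ * K) (hy.ac a ha b hb)
      (hz.ac a ha b hb) fun u hu v hv => ?_
    have hsplit : B (y u) (z u) - B (y v) (z v) =
        B (y u - y v) (z u) + B (y v) (z u - z v) := by
      simp
    rw [dist_eq_norm, dist_eq_norm, dist_eq_norm, hsplit]
    calc ‖B (y u - y v) (z u) + B (y v) (z u - z v)‖
        ≤ ‖B‖ * ‖y u - y v‖ * ‖z u‖ + ‖B‖ * ‖y v‖ * ‖z u - z v‖ :=
          norm_add_le_of_le (B.le_opNorm₂ _ _) (B.le_opNorm₂ _ _)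
      _ ≤ ‖B‖ * ‖y u - y v‖ * L + ‖B‖ * K * ‖z u - z v‖ := by
          gcongr
          exacts [hL u hu, hK v hv]
      _ = ‖B‖ * L * ‖y u - y v‖ + ‖B‖ * K * ‖z u - z v‖ := by ring
  deriv := by
    filter_upwards [hy.deriv, hz.deriv] with x hy hz hx
    exact B.hasDerivAt_of_bilinear (fun _ => hy hx) (fun _ => hz hx)

theorem ringInverse {𝔸 : Type*} [NormedRing 𝔸] [NormedAlgebra ℝ 𝔸] [CompleteSpace 𝔸]
    (hJ : J.OrdConnected) {y f : ℝ → 𝔸} (h : HasCaratheodoryDerivOn J y f)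
    (hu : ∀ x ∈ J, IsUnit (y x)) :
    HasCaratheodoryDerivOn J (fun x => Ring.inverse (y x))
      (fun x => -(Ring.inverse (y x) * f x * Ring.inverse (y x))) where
  ac a ha b hb := by
    have hsub := hJ.uIcc_subset ha hb
    have hcont : ContinuousOn (fun x => Ring.inverse (y x)) (uIcc a b) := by
      intro x hx
      obtain ⟨U, hU⟩ := hu x (hsub hx)
      have hinv : ContinuousAt Ring.inverse (y x) := hU ▸ NormedRing.inverse_continuousAt U
      exact hinv.comp_continuousWithinAt ((h.ac a ha b hb).continuousOn x hx)
    obtain ⟨C, hC⟩ := isCompact_uIcc.exists_bound_of_continuousOn hcont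
    refine absolutelyContinuousOnInterval_of_dist_le (C * C) (h.ac a ha b hb) fun u hu' v hv' => ?_
    have hC0 : 0 ≤ C := (norm_nonneg _).trans (hC u hu')
    rw [dist_eq_norm, dist_eq_norm, norm_sub_rev (y u),
      Ring.inverse_sub_inverse (iff_of_true (hu u (hsub hu')) (hu v (hsub hv')))]
    calc ‖Ring.inverse (y u) * (y v - y u) * Ring.inverse (y v)‖
        ≤ ‖Ring.inverse (y u)‖ * ‖y v - y u‖ * ‖Ring.inverse (y v)‖ := norm_mul₃_le
      _ ≤ C * ‖y v - y u‖ * C := by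
          gcongr
          exacts [hC u hu', hC v hv']
      _ = C * C * ‖y v - y u‖ := by ring
  deriv := by
    filter_upwards [h.deriv] with x h hx
    obtain ⟨U, hU⟩ := hu x hx
    have hinv := hasFDerivAt_ringInverse (𝕜 := ℝ) U
    rw [hU] at hinv
    simpa only [← hU, Ring.inverse_unit] using! hinv.comp_hasDerivAt x (h hx)

theorem eqOn (hJ : J.OrdConnected) {z g : ℝ → E} (hy : HasCaratheodoryDerivOn J y f)
    (hz : HasCaratheodoryDerivOn J z g) (hfg : EqOn f g J) {a : ℝ} (ha : a ∈ J)
    (h : y a = z a) : EqOn y z J := by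
  intro x hx
  obtain ⟨C, hC⟩ := ((hy.sub hz).ac a ha x hx).const_of_ae_hasDerivAt_zero <| by
    filter_upwards [(hy.sub hz).deriv] with t ht hmem
    have htJ := hJ.uIcc_subset ha hx hmem
    simpa only [hfg htJ, sub_self] using ht htJ
  have hconst := (hC x right_mem_uIcc).trans (hC a left_mem_uIcc).symm
  rw [h, sub_self] at hconst
  exact sub_eq_zero.1 hconst

end HasCaratheodoryDerivOn

theorem hasCaratheodoryDerivOn_add_integral [CompleteSpace E] {J : Set ℝ} {f : ℝ → E}
    (hJ : J.OrdConnected) (hf : LocallyIntegrableOn f J) {a : ℝ} (ha : a ∈ J) (v : E) :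
    HasCaratheodoryDerivOn J (fun x => v + ∫ t in a..x, f t) f := by
  rw [locallyIntegrableOn_iff_intervalIntegrable hJ] at hf
  refine ⟨fun b hb c hc => ?_, ?_⟩
  · refine absolutelyContinuousOnInterval_of_dist_le 1
      ((hf b hb c hc).norm.absolutelyContinuousOnInterval_intervalIntegral left_mem_uIcc)
      fun s hs t ht => ?_
    have hsJ := hJ.uIcc_subset hb hc hs
    have htJ := hJ.uIcc_subset hb hc ht
    rw [dist_add_left, one_mul, dist_eq_norm, dist_eq_norm,
      intervalIntegral.integral_interval_sub_left (hf a ha s hsJ) (hf a ha t htJ),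
      intervalIntegral.integral_interval_sub_left (hf b hb s hsJ).norm (hf b hb t htJ).norm]
    exact intervalIntegral.norm_integral_le_abs_integral_norm
  · filter_upwards [ae_hasDerivAt_intervalIntegral ha hf] with x hx hxJ
    exact (hx hxJ).const_add v

end CaratheodoryDeriv

section LinearEquation

theorem integral_mul_integral_pow {f : ℝ → ℝ} {a b : ℝ} (hf : IntervalIntegrable f volume a b)
    (k : ℕ) :
    ∫ t in a..b, f t * (∫ s in a..t, f s) ^ k = (∫ s in a..b, f s) ^ (k + 1) / (k + 1) := by
  set M : ℝ → ℝ := fun t => ∫ s in a..t, f s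
  have hac : AbsolutelyContinuousOnInterval M a b :=
    hf.absolutelyContinuousOnInterval_intervalIntegral left_mem_uIcc
  have hpow : ∀ l : ℕ, AbsolutelyContinuousOnInterval (fun t => M t ^ l) a b := by
    intro l
    induction l with
    | zero => simpa using absolutelyContinuousOnInterval_const (1 : ℝ) a b
    | succ l ih => simpa only [pow_succ] using! ih.mul hac
  have hderiv : ∀ᵐ t, t ∈ uIoc a b →
      deriv (fun t => M t ^ (k + 1)) t = (k + 1) * (f t * M t ^ k) := by
    filter_upwards [hf.ae_hasDerivAt_integral] with t ht hmem
    rw [((ht (uIoc_subset_uIcc hmem) a left_mem_uIcc).fun_pow (k + 1)).deriv, Nat.cast_succ,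
      Nat.add_sub_cancel, mul_assoc, mul_comm (f t)]
  have hFTC := (hpow (k + 1)).integral_deriv_eq_sub
  rw [intervalIntegral.integral_congr_ae hderiv, intervalIntegral.integral_const_mul,
    show M a = 0 from intervalIntegral.integral_same, zero_pow k.succ_ne_zero, sub_zero] at hFTC
  rw [eq_div_iff (by positivity), mul_comm]
  exact hFTC

theorem exists_abs_integral_eq_mul_of_nonneg {f : ℝ → ℝ} (hf : ∀ t, 0 ≤ f t) (a b : ℝ) :
    ∃ σ : ℝ, |σ| = 1 ∧ ∀ t ∈ uIcc a b, |∫ s in a..t, f s| = σ * ∫ s in a..t, f s := by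
  rcases le_total a b with hab | hab
  · refine ⟨1, abs_one, fun t ht => ?_⟩
    rw [uIcc_of_le hab] at ht
    rw [one_mul, abs_of_nonneg (intervalIntegral.integral_nonneg ht.1 fun s _ => hf s)]
  · refine ⟨-1, by simp, fun t ht => ?_⟩
    rw [uIcc_of_ge hab] at ht
    rw [intervalIntegral.integral_symm, abs_neg, neg_one_mul, neg_neg,
      abs_of_nonneg (intervalIntegral.integral_nonneg ht.2 fun s _ => hf s)]

theorem abs_integral_mul_abs_integral_pow {f : ℝ → ℝ} {a b : ℝ} (hf0 : ∀ t, 0 ≤ f t)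
    (hf : IntervalIntegrable f volume a b) (k : ℕ) :
    |∫ t in a..b, f t * |∫ s in a..t, f s| ^ k| = |∫ t in a..b, f t| ^ (k + 1) / (k + 1) := by
  obtain ⟨σ, hσ, hM⟩ := exists_abs_integral_eq_mul_of_nonneg hf0 a b
  have hcongr : ∫ t in a..b, f t * |∫ s in a..t, f s| ^ k =
      ∫ t in a..b, σ ^ k * (f t * (∫ s in a..t, f s) ^ k) := by
    refine intervalIntegral.integral_congr fun t ht => ?_
    rw [hM t ht, mul_pow, mul_left_comm]
  rw [hcongr, intervalIntegral.integral_const_mul, integral_mul_integral_pow hf, abs_mul, abs_pow,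
    hσ, one_pow, one_mul, abs_div, abs_pow, abs_of_nonneg (by positivity : (0 : ℝ) ≤ k + 1)]

variable {E : Type*} [NormedAddCommGroup E] [NormedSpace ℝ E] {L : ℝ → E →L[ℝ] E} {a b : ℝ}

theorem intervalIntegrable_clm_apply {y : ℝ → E} (hL : IntervalIntegrable L volume a b)
    (hy : ContinuousOn y (uIcc a b)) : IntervalIntegrable (fun t => L t (y t)) volume a b :=
  intervalIntegrable_bilin_apply (.id ℝ (E →L[ℝ] E)) hL hy

theorem norm_iterate_integral_le {φ : ℕ → ℝ → E} {C : ℝ} (hL : IntervalIntegrable L volume a b)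
    (hzero : ∀ t ∈ uIcc a b, ‖φ 0 t‖ ≤ C)
    (hsucc : ∀ k, ∀ t ∈ uIcc a b, φ (k + 1) t = ∫ s in a..t, L s (φ k s)) (k : ℕ) :
    ∀ t ∈ uIcc a b, ‖φ k t‖ ≤ C * (|∫ s in a..t, ‖L s‖| ^ k / k.factorial) := by
  induction k with
  | zero => simpa using hzero
  | succ k ih =>
    intro t ht
    have hsub := uIcc_subset_uIcc_left ht
    have hLt : IntervalIntegrable (fun s => ‖L s‖) volume a t := (hL.mono_set hsub).norm
    have hC : 0 ≤ C := (norm_nonneg _).trans (hzero t ht)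
    have hM : ContinuousOn (fun s => |∫ s in a..s, ‖L s‖| ^ k) (uIcc a t) :=
      (intervalIntegral.continuousOn_primitive_interval' hLt left_mem_uIcc).abs.pow k
    calc ‖φ (k + 1) t‖ = ‖∫ s in a..t, L s (φ k s)‖ := by rw [hsucc k t ht]
      _ ≤ |∫ s in a..t, C / k.factorial * (‖L s‖ * |∫ s in a..s, ‖L s‖| ^ k)| := by
          refine intervalIntegral.norm_integral_le_abs_of_norm_le ?_
            ((hLt.mul_continuousOn hM).const_mul _)
          refine (ae_restrict_iff' measurableSet_uIoc).2 (Eventually.of_forall fun s hs => ?_)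
          calc ‖L s (φ k s)‖ ≤ ‖L s‖ * ‖φ k s‖ := (L s).le_opNorm _
            _ ≤ ‖L s‖ * (C * (|∫ s in a..s, ‖L s‖| ^ k / k.factorial)) := by
                gcongr
                exact ih s (hsub (uIoc_subset_uIcc hs))
            _ = _ := by ring
      _ = C / k.factorial * (|∫ s in a..t, ‖L s‖| ^ (k + 1) / (k + 1)) := by
          rw [intervalIntegral.integral_const_mul, abs_mul, abs_of_nonneg (by positivity),
            abs_integral_mul_abs_integral_pow (fun _ => norm_nonneg _) hLt]
      _ = C * (|∫ s in a..t, ‖L s‖| ^ (k + 1) / (k + 1).factorial) := by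
          rw [Nat.factorial_succ]
          push_cast
          field_simp

theorem norm_iterate_integral_le_of_uIcc {φ : ℕ → ℝ → E} {C : ℝ}
    (hL : IntervalIntegrable L volume a b) (hzero : ∀ t ∈ uIcc a b, ‖φ 0 t‖ ≤ C)
    (hsucc : ∀ k, ∀ t ∈ uIcc a b, φ (k + 1) t = ∫ s in a..t, L s (φ k s)) (k : ℕ) :
    ∀ t ∈ uIcc a b, ‖φ k t‖ ≤ C * (|∫ s in a..b, ‖L s‖| ^ k / k.factorial) := by
  intro t ht
  refine (norm_iterate_integral_le hL hzero hsucc k t ht).trans ?_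
  have hC : 0 ≤ C := (norm_nonneg _).trans (hzero t ht)
  have hmono : |∫ s in a..t, ‖L s‖| ≤ |∫ s in a..b, ‖L s‖| :=
    intervalIntegral.abs_integral_mono_interval
      (uIoc_subset_uIoc_of_uIcc_subset_uIcc (uIcc_subset_uIcc_left ht))
      (Eventually.of_forall fun _ => norm_nonneg _) hL.norm
  gcongr

theorem eqOn_of_hasCaratheodoryDerivOn_clm_apply [CompleteSpace E] {I : Set ℝ} {y z : ℝ → E}
    (hI : I.OrdConnected) (hL : LocallyIntegrableOn L I) (ha : a ∈ I)
    (hy : HasCaratheodoryDerivOn I y fun t => L t (y t))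
    (hz : HasCaratheodoryDerivOn I z fun t => L t (z t)) (h : y a = z a) : EqOn y z I := by
  set u : ℝ → E := fun t => y t - z t
  have hLi := (locallyIntegrableOn_iff_intervalIntegrable hI).1 hL
  have hu : HasCaratheodoryDerivOn I u fun t => L t (u t) :=
    (hy.sub hz).congr_deriv fun t _ => (map_sub (L t) _ _).symm
  have hint : LocallyIntegrableOn (fun t => L t (u t)) I :=
    locallyIntegrableOn_bilin_apply hI (.id ℝ (E →L[ℝ] E)) hL hu.continuousOn
  have heq : EqOn u (fun t => 0 + ∫ s in a..t, L s (u s)) I :=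
    hu.eqOn hI (hasCaratheodoryDerivOn_add_integral hI hint ha 0) (fun _ _ => rfl) ha
      (by simp [u, h])
  intro b hb
  have hab := hI.uIcc_subset ha hb
  obtain ⟨C, hC⟩ := isCompact_uIcc.exists_bound_of_continuousOn (hu.continuousOn.mono hab)
  have hle := fun k => norm_iterate_integral_le_of_uIcc (φ := fun _ => u) (hLi a ha b hb) hC
    (fun _ t ht => by simpa using heq (hab ht)) k b right_mem_uIcc
  have hlim := (FloorSemiring.tendsto_pow_div_factorial_atTop
    |∫ s in a..b, ‖L s‖|).const_mul C
  rw [mul_zero] at hlim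
  exact sub_eq_zero.1 (norm_le_zero_iff.1 (ge_of_tendsto' hlim hle))

/-- The terms of the Peano-Baker series of `y' = L y`, `y a = v`. -/
def peanoBaker (L : ℝ → E →L[ℝ] E) (a : ℝ) (v : E) : ℕ → ℝ → E
  | 0 => fun _ => v
  | k + 1 => fun t => ∫ s in a..t, L s (peanoBaker L a v k s)

variable {v : E}

theorem continuousOn_peanoBaker (hL : IntervalIntegrable L volume a b) (k : ℕ) :
    ContinuousOn (peanoBaker L a v k) (uIcc a b) := by
  induction k with
  | zero => exact continuousOn_const
  | succ k ih =>
    exact intervalIntegral.continuousOn_primitive_interval'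
      (intervalIntegrable_clm_apply hL ih) left_mem_uIcc

theorem norm_peanoBaker_le (hL : IntervalIntegrable L volume a b) (k : ℕ) :
    ∀ t ∈ uIcc a b,
      ‖peanoBaker L a v k t‖ ≤ ‖v‖ * (|∫ s in a..b, ‖L s‖| ^ k / k.factorial) :=
  norm_iterate_integral_le_of_uIcc hL (fun _ _ => le_rfl) (fun _ _ _ => rfl) k

theorem summable_const_mul_pow_div_factorial (C x : ℝ) :
    Summable fun k : ℕ => C * (x ^ k / k.factorial) :=
  (Real.summable_pow_div_factorial x).mul_left C

variable [CompleteSpace E]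

theorem continuousOn_tsum_peanoBaker (hL : IntervalIntegrable L volume a b) :
    ContinuousOn (fun t => ∑' k, peanoBaker L a v k t) (uIcc a b) :=
  continuousOn_tsum (continuousOn_peanoBaker hL) (summable_const_mul_pow_div_factorial _ _)
    fun k t ht => norm_peanoBaker_le hL k t ht

theorem summable_peanoBaker (hL : IntervalIntegrable L volume a b) {t : ℝ} (ht : t ∈ uIcc a b) :
    Summable fun k => peanoBaker L a v k t :=
  .of_norm_bounded (summable_const_mul_pow_div_factorial _ _)
    fun k => norm_peanoBaker_le hL k t ht

theorem tsum_peanoBaker_eq (hL : IntervalIntegrable L volume a b) :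
    ∑' k, peanoBaker L a v k b = v + ∫ t in a..b, L t (∑' k, peanoBaker L a v k t) := by
  rw [(summable_peanoBaker hL right_mem_uIcc).tsum_eq_zero_add]
  congr 1
  refine HasSum.tsum_eq ?_
  set K : ℝ := |∫ t in a..b, ‖L t‖|
  refine intervalIntegral.hasSum_integral_of_dominated_convergence
    (fun k t => ‖L t‖ * (‖v‖ * (K ^ k / k.factorial))) (fun k => ?_) (fun k => ?_) ?_ ?_ ?_
  · exact (intervalIntegrable_clm_apply hL
      (continuousOn_peanoBaker hL k)).aestronglyMeasurable_restrict_uIoc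
  · refine Eventually.of_forall fun t ht => (L t).le_opNorm_of_le ?_
    exact norm_peanoBaker_le hL k t (uIoc_subset_uIcc ht)
  · exact Eventually.of_forall fun t _ =>
      (summable_const_mul_pow_div_factorial ‖v‖ K).mul_left _
  · simp only [tsum_mul_left]
    exact hL.norm.mul_const _
  · exact Eventually.of_forall fun t ht =>
      (L t).hasSum (summable_peanoBaker hL (uIoc_subset_uIcc ht)).hasSum

theorem exists_hasCaratheodoryDerivOn_clm_apply {I : Set ℝ} (hI : I.OrdConnected)
    (hL : LocallyIntegrableOn L I) (ha : a ∈ I) (v : E) :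
    ∃ y : ℝ → E, y a = v ∧ HasCaratheodoryDerivOn I y fun t => L t (y t) := by
  have hLi := (locallyIntegrableOn_iff_intervalIntegrable hI).1 hL
  set y : ℝ → E := fun t => ∑' k, peanoBaker L a v k t
  have hint : ∀ b ∈ I, IntervalIntegrable (fun t => L t (y t)) volume a b := fun b hb =>
    intervalIntegrable_clm_apply (hLi a ha b hb) (continuousOn_tsum_peanoBaker (hLi a ha b hb))
  have hloc : LocallyIntegrableOn (fun t => L t (y t)) I :=
    (locallyIntegrableOn_iff_intervalIntegrable hI).2 fun b hb c hc =>
      (hint b hb).symm.trans (hint c hc)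
  refine ⟨fun t => v + ∫ s in a..t, L s (y s), by simp, ?_⟩
  refine (hasCaratheodoryDerivOn_add_integral hI hloc ha v).congr_deriv fun t ht => ?_
  exact congrArg (L t) (tsum_peanoBaker_eq (hLi a ha t ht))

end LinearEquation

section Entrywise

theorem locallyIntegrableOn_finsetSum {α E : Type*} [NormedAddCommGroup E] {J : Set ℝ}
    {f : α → ℝ → E} (s : Finset α) (hf : ∀ k ∈ s, LocallyIntegrableOn (f k) J) :
    LocallyIntegrableOn (fun x => ∑ k ∈ s, f k x) J := by
  classical
  induction s using Finset.induction_on with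
  | empty => simpa using locallyIntegrableOn_zero
  | insert k s hk ih =>
    simp only [Finset.sum_insert hk]
    exact (hf k (s.mem_insert_self k)).add (ih fun l hl => hf l (Finset.mem_insert_of_mem hl))

namespace HasAEDerivOn

variable {ι κ μ : Type} {I J : Set ℝ} {Y F : ℝ → Matrix ι κ ℂ}

theorem entry (h : HasAEDerivOn J Y F) (i : ι) (l : κ) :
    HasCaratheodoryDerivOn J (fun x => Y x i l) (fun x => F x i l) where
  ac := h.ac i l
  deriv := h.deriv.mono fun _ hx hxJ => hx hxJ i l

theorem of_entry [Countable ι] [Countable κ]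
    (h : ∀ i l, HasCaratheodoryDerivOn J (fun x => Y x i l) (fun x => F x i l)) :
    HasAEDerivOn J Y F where
  ac i l := (h i l).ac
  deriv := by
    filter_upwards [ae_all_iff.2 fun i => ae_all_iff.2 fun l => (h i l).deriv] with x hx hxJ i l
      using hx i l hxJ

theorem mono (h : HasAEDerivOn I Y F) (hJI : J ⊆ I) : HasAEDerivOn J Y F where
  ac i l a ha b hb := h.ac i l a (hJI ha) b (hJI hb)
  deriv := h.deriv.mono fun _ hx hxJ => hx (hJI hxJ)

theorem congr_deriv {G : ℝ → Matrix ι κ ℂ} (h : HasAEDerivOn J Y F)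
    (hFG : ∀ x ∈ J, F x = G x) : HasAEDerivOn J Y G where
  ac := h.ac
  deriv := h.deriv.mono fun x hx hxJ => hFG x hxJ ▸ hx hxJ

theorem continuousOn (h : HasAEDerivOn J Y F) : ContinuousOn Y J :=
  continuousOn_pi.2 fun i => continuousOn_pi.2 fun l => (h.entry i l).continuousOn

theorem eqOn (hJ : J.OrdConnected) {Z G : ℝ → Matrix ι κ ℂ} (hY : HasAEDerivOn J Y F)
    (hZ : HasAEDerivOn J Z G) (hFG : ∀ x ∈ J, F x = G x) {a : ℝ} (ha : a ∈ J) (h : Y a = Z a) :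
    EqOn Y Z J := by
  intro x hx
  ext i l
  exact (hY.entry i l).eqOn hJ (hZ.entry i l) (fun t ht => congrFun₂ (hFG t ht) i l) ha
    (congrFun₂ h i l) hx

protected theorem const (J : Set ℝ) (M : Matrix ι κ ℂ) :
    HasAEDerivOn J (fun _ => M) (fun _ => 0) where
  ac i l a _ b _ := absolutelyContinuousOnInterval_const (M i l) a b
  deriv := Eventually.of_forall fun _ _ _ _ => hasDerivAt_const _ _

theorem sub {Z G : ℝ → Matrix ι κ ℂ} (hY : HasAEDerivOn J Y F) (hZ : HasAEDerivOn J Z G) :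
    HasAEDerivOn J (fun x => Y x - Z x) (fun x => F x - G x) where
  ac i l := ((hY.entry i l).sub (hZ.entry i l)).ac
  deriv := by
    filter_upwards [hY.deriv, hZ.deriv] with x hY hZ hx i l using (hY hx i l).sub (hZ hx i l)

theorem conjTranspose (h : HasAEDerivOn J Y F) :
    HasAEDerivOn J (fun x => (Y x)ᴴ) (fun x => (F x)ᴴ) where
  ac i l := ((h.entry l i).clm_apply Complex.conjCLE.toContinuousLinearMap).ac
  deriv := h.deriv.mono fun _ hx hxJ i l => (hx hxJ l i).star

variable [Fintype κ]

theorem mul [Countable ι] [Countable μ] {Z G : ℝ → Matrix κ μ ℂ} (hY : HasAEDerivOn J Y F)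
    (hZ : HasAEDerivOn J Z G) :
    HasAEDerivOn J (fun x => Y x * Z x) (fun x => Y x * G x + F x * Z x) :=
  of_entry fun i l => by
    simpa [Matrix.mul_apply, Finset.sum_add_distrib] using
      HasCaratheodoryDerivOn.sum Finset.univ fun k _ =>
        (hY.entry i k).bilin_apply (ContinuousLinearMap.mul ℝ ℂ) (hZ.entry k l)

theorem const_mul [Countable ι] [Countable μ] (M : Matrix ι κ ℂ) {Z G : ℝ → Matrix κ μ ℂ}
    (hZ : HasAEDerivOn J Z G) : HasAEDerivOn J (fun x => M * Z x) (fun x => M * G x) := by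
  simpa using (HasAEDerivOn.const J M).mul hZ

theorem mul_const [Countable ι] [Countable μ] (hY : HasAEDerivOn J Y F) (M : Matrix κ μ ℂ) :
    HasAEDerivOn J (fun x => Y x * M) (fun x => F x * M) := by
  simpa using hY.mul (HasAEDerivOn.const J M)

end HasAEDerivOn

namespace LocSummableOn

variable {α ι κ μ : Type} {I J : Set ℝ} {F : ℝ → Matrix ι κ ℂ}

theorem mono (h : LocSummableOn I F) (hJI : J ⊆ I) : LocSummableOn J F :=
  fun i l => (h i l).mono_set hJI

theorem neg (h : LocSummableOn J F) : LocSummableOn J (fun x => -F x) :=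
  fun i l => (h i l).neg

theorem sum [Fintype α] {F : α → ℝ → Matrix ι κ ℂ} (h : ∀ k, LocSummableOn J (F k)) :
    LocSummableOn J (fun x => ∑ k, F k x) := fun i l => by
  simpa only [Matrix.sum_apply] using
    locallyIntegrableOn_finsetSum Finset.univ fun k _ => h k i l

theorem mul_continuousOn [Fintype κ] (hJ : J.OrdConnected) {M : ℝ → Matrix κ μ ℂ}
    (hF : LocSummableOn J F) (hM : ContinuousOn M J) :
    LocSummableOn J (fun x => F x * M x) := fun i l => by
  simpa only [Matrix.mul_apply, ContinuousLinearMap.mul_apply'] using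
    locallyIntegrableOn_finsetSum Finset.univ fun k _ =>
      locallyIntegrableOn_bilin_apply hJ (ContinuousLinearMap.mul ℝ ℂ) (hF i k)
        (continuousOn_pi.1 (continuousOn_pi.1 hM k) l)

theorem continuousOn_mul [Fintype κ] (hJ : J.OrdConnected) {M : ℝ → Matrix ι κ ℂ}
    {F : ℝ → Matrix κ μ ℂ} (hM : ContinuousOn M J) (hF : LocSummableOn J F) :
    LocSummableOn J (fun x => M x * F x) := fun i l => by
  simpa only [Matrix.mul_apply, ContinuousLinearMap.flip_apply,
    ContinuousLinearMap.mul_apply'] using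
    locallyIntegrableOn_finsetSum Finset.univ fun k _ =>
      locallyIntegrableOn_bilin_apply hJ (ContinuousLinearMap.mul ℝ ℂ).flip (hF k l)
        (continuousOn_pi.1 (continuousOn_pi.1 hM i) k)

theorem exists_hasAEDerivOn [Countable ι] [Countable κ] (hJ : J.OrdConnected)
    (hF : LocSummableOn J F) {a : ℝ} (ha : a ∈ J) (M : Matrix ι κ ℂ) :
    ∃ Y, Y a = M ∧ HasAEDerivOn J Y F :=
  ⟨fun x => Matrix.of fun i l => M i l + ∫ t in a..x, F t i l, by ext; simp,
    .of_entry fun i l => hasCaratheodoryDerivOn_add_integral hJ (hF i l) ha (M i l)⟩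

end LocSummableOn

end Entrywise

section Normed

open scoped Matrix.Norms.Operator

/-- The topology of the operator norm. It agrees with the entrywise one, but not by reducible
unfolding, so instance search has to find this one first. -/
local instance operatorTopology {ι κ : Type} [Fintype ι] [Fintype κ] :
    TopologicalSpace (Matrix ι κ ℂ) :=
  PseudoMetricSpace.toUniformSpace.toTopologicalSpace

/-- Matrix multiplication as a continuous real bilinear map. -/
def mulCLM (ι κ μ : Type) [Fintype ι] [Fintype κ] [Fintype μ] :
    Matrix ι κ ℂ →L[ℝ] Matrix κ μ ℂ →L[ℝ] Matrix ι μ ℂ :=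
  (LinearMap.mk₂ ℝ (· * ·) Matrix.add_mul (fun a M N => Matrix.smul_mul a M N) Matrix.mul_add
    (fun a M N => Matrix.mul_smul M a N)).toContinuousBilinearMap

variable {α ι κ μ : Type} [Fintype α] [Fintype ι] [Fintype κ] [Fintype μ] {J : Set ℝ}

theorem hasAEDerivOn_iff {Y F : ℝ → Matrix ι κ ℂ} :
    HasAEDerivOn J Y F ↔ HasCaratheodoryDerivOn J Y F := by
  classical
  constructor
  · intro h
    have hsum := HasCaratheodoryDerivOn.sum Finset.univ fun i _ =>
      HasCaratheodoryDerivOn.sum Finset.univ fun l _ =>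
        (h.entry i l).clm_apply (Matrix.singleLinearMap ℝ i l).toContinuousLinearMap
    simpa [← Matrix.matrix_eq_sum_single] using hsum
  · exact fun h => .of_entry fun i l =>
      h.clm_apply (Matrix.entryLinearMap ℝ ℂ i l).toContinuousLinearMap

theorem locSummableOn_iff {F : ℝ → Matrix ι κ ℂ} :
    LocSummableOn J F ↔ LocallyIntegrableOn F J := by
  classical
  constructor
  · intro h
    have hsum := locallyIntegrableOn_finsetSum Finset.univ fun i _ =>
      locallyIntegrableOn_finsetSum Finset.univ fun l _ =>
        (Matrix.singleLinearMap ℝ i l).toContinuousLinearMap.locallyIntegrableOn_comp (h i l)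
    simpa [← Matrix.matrix_eq_sum_single] using hsum
  · intro h i l
    exact (Matrix.entryLinearMap ℝ ℂ i l).toContinuousLinearMap.locallyIntegrableOn_comp h

theorem HasAEDerivOn.inv [DecidableEq ι] {Y F : ℝ → Matrix ι ι ℂ} (hJ : J.OrdConnected)
    (h : HasAEDerivOn J Y F) (hu : ∀ x ∈ J, IsUnit (Y x)) :
    HasAEDerivOn J (fun x => (Y x)⁻¹) (fun x => -((Y x)⁻¹ * F x * (Y x)⁻¹)) := by
  simpa only [Matrix.nonsing_inv_eq_ringInverse] using
    hasAEDerivOn_iff.2 ((hasAEDerivOn_iff.1 h).ringInverse hJ hu)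

section TwoSided

variable {R : α → Matrix ι ι ℂ} {q : α → ℝ → Matrix κ κ ℂ} {a : ℝ}

/-- The operator `N ↦ ∑ₖ Rₖ N qₖ(x)`, which makes the two-sided matrix equation
`P' = ∑ₖ Rₖ P qₖ` a linear equation in a normed space. -/
def twoSidedMul (R : α → Matrix ι ι ℂ) (q : α → ℝ → Matrix κ κ ℂ) (x : ℝ) :
    Matrix ι κ ℂ →L[ℝ] Matrix ι κ ℂ :=
  ∑ k, (ContinuousLinearMap.compL ℝ _ _ _ (mulCLM ι ι κ (R k))) ((mulCLM ι κ κ).flip (q k x))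

theorem twoSidedMul_apply (x : ℝ) (N : Matrix ι κ ℂ) :
    twoSidedMul R q x N = ∑ k, R k * N * q k x := by
  simp [twoSidedMul, mulCLM, Matrix.mul_assoc]

theorem locallyIntegrableOn_twoSidedMul (hq : ∀ k, LocSummableOn J (q k)) :
    LocallyIntegrableOn (twoSidedMul R q) J :=
  locallyIntegrableOn_finsetSum _ fun k _ =>
    ((ContinuousLinearMap.compL ℝ _ _ _ (mulCLM ι ι κ (R k))).comp
      (mulCLM ι κ κ).flip).locallyIntegrableOn_comp (locSummableOn_iff.1 (hq k))

theorem exists_hasAEDerivOn_twoSided (hJ : J.OrdConnected) (hq : ∀ k, LocSummableOn J (q k))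
    (ha : a ∈ J) (M : Matrix ι κ ℂ) :
    ∃ P, P a = M ∧ HasAEDerivOn J P (fun x => ∑ k, R k * P x * q k x) := by
  simpa only [hasAEDerivOn_iff, twoSidedMul_apply] using
    exists_hasCaratheodoryDerivOn_clm_apply hJ (locallyIntegrableOn_twoSidedMul (R := R) hq) ha M

theorem eqOn_of_hasAEDerivOn_twoSided {P P' : ℝ → Matrix ι κ ℂ} (hJ : J.OrdConnected)
    (hq : ∀ k, LocSummableOn J (q k)) (ha : a ∈ J)
    (hP : HasAEDerivOn J P (fun x => ∑ k, R k * P x * q k x))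
    (hP' : HasAEDerivOn J P' (fun x => ∑ k, R k * P' x * q k x)) (h : P a = P' a) :
    EqOn P P' J := by
  simp only [hasAEDerivOn_iff, ← twoSidedMul_apply] at hP hP'
  exact eqOn_of_hasCaratheodoryDerivOn_clm_apply hJ (locallyIntegrableOn_twoSidedMul hq) ha
    hP hP' h

end TwoSided

end Normed

section Resolvent

variable {n : ℕ} {A : Matrix (Fin n) (Fin n) ℂ} {z w : ℂ}

theorem isUnit_sub_smul_one (hz : z ∉ spectrum ℂ A) : IsUnit (A - z • 1) := by
  rw [spectrum.notMem_iff, Algebra.algebraMap_eq_smul_one, ← IsUnit.neg_iff, neg_sub] at hz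
  exact hz

theorem mul_res (hz : z ∉ spectrum ℂ A) : A * res A z = 1 + z • res A z := by
  have h : (A - z • 1) * res A z = 1 :=
    Matrix.mul_nonsing_inv _ ((Matrix.isUnit_iff_isUnit_det _).1 (isUnit_sub_smul_one hz))
  rwa [Matrix.sub_mul, Matrix.smul_mul, Matrix.one_mul, sub_eq_iff_eq_add] at h

theorem res_mul (hz : z ∉ spectrum ℂ A) : res A z * A = 1 + z • res A z := by
  have h : res A z * (A - z • 1) = 1 :=
    Matrix.nonsing_inv_mul _ ((Matrix.isUnit_iff_isUnit_det _).1 (isUnit_sub_smul_one hz))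
  rwa [Matrix.mul_sub, Matrix.mul_smul, Matrix.mul_one, sub_eq_iff_eq_add] at h

theorem res_sub_res (hz : z ∉ spectrum ℂ A) (hw : w ∉ spectrum ℂ A) :
    res A z - res A w = (z - w) • (res A z * res A w) := by
  rw [res, res, Matrix.inv_sub_inv (iff_of_true (isUnit_sub_smul_one hz) (isUnit_sub_smul_one hw)),
    sub_sub_sub_cancel_left, ← sub_smul, Matrix.mul_smul, Matrix.mul_one, Matrix.smul_mul]

theorem res_conjTranspose (A : Matrix (Fin n) (Fin n) ℂ) (z : ℂ) :
    (res A z)ᴴ = res Aᴴ (star z) := by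
  simp [res, Matrix.conjTranspose_nonsing_inv]

theorem star_notMem_spectrum_conjTranspose (hz : z ∉ spectrum ℂ A) : star z ∉ spectrum ℂ Aᴴ := by
  have h : z ∈ resolventSet ℂ A := not_not.1 hz
  rw [← star_star A] at h
  exact not_not.2 (spectrum.star_mem_resolventSet_iff.2 h)

end Resolvent

section SNode

variable {n : ℕ} {ι : Type} {A₁ A₂ S : Matrix (Fin n) (Fin n) ℂ} {P : Matrix (Fin n) ι ℂ}
  {Q : Matrix ι (Fin n) ℂ} {z w : ℂ}

section Transfer

variable [DecidableEq ι]

/-- The transfer matrix function `I - Π₂^* S⁻¹ (A₁ - z)⁻¹ Π₁` of an S-node. -/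
def nodeTransfer (A₁ S : Matrix (Fin n) (Fin n) ℂ) (P : Matrix (Fin n) ι ℂ)
    (Q : Matrix ι (Fin n) ℂ) (z : ℂ) : Matrix ι ι ℂ :=
  1 - Q * S⁻¹ * res A₁ z * P

/-- The matrix function `I + Π₂^* (A₂ - z)⁻¹ S⁻¹ Π₁`, inverse to the transfer matrix function of
an S-node. -/
def nodeCotransfer (A₂ S : Matrix (Fin n) (Fin n) ℂ) (P : Matrix (Fin n) ι ℂ)
    (Q : Matrix ι (Fin n) ℂ) (z : ℂ) : Matrix ι ι ℂ :=
  1 + Q * res A₂ z * S⁻¹ * P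

theorem nodeTransfer_sub_nodeTransfer (hz : z ∉ spectrum ℂ A₁) (hw : w ∉ spectrum ℂ A₁) :
    nodeTransfer A₁ S P Q z - nodeTransfer A₁ S P Q w =
      (w - z) • (Q * S⁻¹ * res A₁ z * res A₁ w * P) := by
  calc nodeTransfer A₁ S P Q z - nodeTransfer A₁ S P Q w
      = -(Q * S⁻¹ * (res A₁ z - res A₁ w) * P) := by
        rw [nodeTransfer, nodeTransfer, Matrix.mul_sub, Matrix.sub_mul]
        abel
    _ = _ := by
        rw [res_sub_res hz hw, Matrix.mul_smul, Matrix.smul_mul, ← neg_smul, neg_sub,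
          Matrix.mul_assoc _ (res A₁ z)]

end Transfer

variable [Fintype ι]

/-- The matrices form an S-node `A₁ S - S A₂ = Π₁ Π₂^*`, where `P = Π₁` and `Q = Π₂^*`. -/
def IsSNode (A₁ A₂ S : Matrix (Fin n) (Fin n) ℂ) (P : Matrix (Fin n) ι ℂ)
    (Q : Matrix ι (Fin n) ℂ) : Prop :=
  A₁ * S - S * A₂ = P * Q

theorem IsSNode.inv_mul_mul_inv (h : IsSNode A₁ A₂ S P Q) (hS : IsUnit S) :
    S⁻¹ * P * Q * S⁻¹ = S⁻¹ * A₁ - A₂ * S⁻¹ := by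
  have hdet := (Matrix.isUnit_iff_isUnit_det _).1 hS
  calc S⁻¹ * P * Q * S⁻¹ = S⁻¹ * (A₁ * S - S * A₂) * S⁻¹ := by rw [h, ← Matrix.mul_assoc]
    _ = S⁻¹ * A₁ * (S * S⁻¹) - S⁻¹ * S * (A₂ * S⁻¹) := by noncomm_ring
    _ = S⁻¹ * A₁ - A₂ * S⁻¹ := by
      rw [Matrix.mul_nonsing_inv _ hdet, Matrix.nonsing_inv_mul _ hdet, Matrix.mul_one,
        Matrix.one_mul]

theorem IsSNode.res_mul_res (h : IsSNode A₁ A₂ S P Q) (hS : IsUnit S) (hz : z ∉ spectrum ℂ A₁)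
    (hw : w ∉ spectrum ℂ A₂) :
    res A₂ w * S⁻¹ * P * (Q * S⁻¹ * res A₁ z) =
      res A₂ w * S⁻¹ - S⁻¹ * res A₁ z + (z - w) • (res A₂ w * S⁻¹ * res A₁ z) := by
  calc res A₂ w * S⁻¹ * P * (Q * S⁻¹ * res A₁ z)
      = res A₂ w * (S⁻¹ * P * Q * S⁻¹) * res A₁ z := by simp only [Matrix.mul_assoc]
    _ = res A₂ w * S⁻¹ * (A₁ * res A₁ z) - res A₂ w * A₂ * S⁻¹ * res A₁ z := by
      rw [h.inv_mul_mul_inv hS]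
      noncomm_ring
    _ = _ := by
      rw [mul_res hz, res_mul hw, Matrix.mul_add, Matrix.mul_one, Matrix.mul_smul, Matrix.add_mul,
        Matrix.add_mul, Matrix.one_mul, Matrix.smul_mul, Matrix.smul_mul]
      module

variable [DecidableEq ι]

theorem nodeCoeff_eq (c : ℂ) (q : Matrix ι ι ℂ) :
    nodeCoeff A₁ A₂ S P Q c q = nodeTransfer A₁ S P Q c * q * nodeCotransfer A₂ S P Q c := by
  simp only [nodeCoeff, nodeTransfer, nodeCotransfer]
  noncomm_ring

theorem IsSNode.nodeCotransfer_mul_nodeTransfer (h : IsSNode A₁ A₂ S P Q) (hS : IsUnit S)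
    (hz : z ∉ spectrum ℂ A₁) (hw : w ∉ spectrum ℂ A₂) :
    nodeCotransfer A₂ S P Q w * nodeTransfer A₁ S P Q z =
      1 - (z - w) • (Q * res A₂ w * S⁻¹ * res A₁ z * P) := by
  have hcross := congrArg (fun M => Q * M * P) (h.res_mul_res hS hz hw)
  simp only [Matrix.mul_add, Matrix.mul_sub, Matrix.add_mul, Matrix.sub_mul, Matrix.mul_smul,
    Matrix.smul_mul, Matrix.mul_assoc] at hcross
  simp only [nodeCotransfer, nodeTransfer, Matrix.add_mul, Matrix.mul_sub, Matrix.mul_one,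
    Matrix.one_mul, Matrix.mul_assoc, hcross]
  module

theorem IsSNode.isUnit_nodeTransfer (h : IsSNode A₁ A₂ S P Q) (hS : IsUnit S)
    (hz : z ∉ spectrum ℂ A₁) (hz' : z ∉ spectrum ℂ A₂) : IsUnit (nodeTransfer A₁ S P Q z) := by
  refine .of_mul_eq_one_right (nodeCotransfer A₂ S P Q z) ?_
  rw [h.nodeCotransfer_mul_nodeTransfer hS hz hz', sub_self, zero_smul, sub_zero]

theorem IsSNode.nodeCoeff_mul_nodeTransfer_sub (h : IsSNode A₁ A₂ S P Q) (hS : IsUnit S)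
    (hz : z ∉ spectrum ℂ A₁) (hw : w ∉ spectrum ℂ A₁) (hw' : w ∉ spectrum ℂ A₂)
    (q : Matrix ι ι ℂ) :
    nodeCoeff A₁ A₂ S P Q w q * nodeTransfer A₁ S P Q z - nodeTransfer A₁ S P Q z * q =
      (z - w) • (Q * S⁻¹ * res A₁ z * res A₁ w * P * q -
        nodeTransfer A₁ S P Q w * q * (Q * res A₂ w * S⁻¹ * res A₁ z * P)) := by
  have hdiff := eq_add_of_sub_eq (nodeTransfer_sub_nodeTransfer (S := S) (P := P) (Q := Q) hz hw)
  rw [nodeCoeff_eq, Matrix.mul_assoc _ (nodeCotransfer A₂ S P Q w),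
    h.nodeCotransfer_mul_nodeTransfer hS hz hw', hdiff, Matrix.mul_sub, Matrix.mul_one,
    Matrix.mul_smul, Matrix.add_mul, Matrix.smul_mul]
  module

end SNode

section SNodeFlow

variable {n : ℕ} {α ι : Type} [Fintype α] [Fintype ι] {J : Set ℝ} {c : α → ℂ}
  {q : α → ℝ → Matrix ι ι ℂ} {A₁ A₂ : Matrix (Fin n) (Fin n) ℂ} {P : ℝ → Matrix (Fin n) ι ℂ}
  {Q : ℝ → Matrix ι (Fin n) ℂ} {S : ℝ → Matrix (Fin n) (Fin n) ℂ} {z : ℂ}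

/-- The coefficient `-∑ₖ (z - cₖ)⁻¹ qₖ(x)` of a system with simple poles in the spectral
parameter `z`. -/
def poleSystem (c : α → ℂ) (q : α → ℝ → Matrix ι ι ℂ) (z : ℂ) (x : ℝ) : Matrix ι ι ℂ :=
  -∑ k, (z - c k)⁻¹ • q k x

/-- The equations of the generalised Bäcklund-Darboux transformation of the system with
coefficient `poleSystem c q`, for a not necessarily symmetric S-node with `P = Π₁` and
`Q = Π₂^*`. -/
structure IsSNodeFlow (J : Set ℝ) (c : α → ℂ) (q : α → ℝ → Matrix ι ι ℂ)
    (A₁ A₂ : Matrix (Fin n) (Fin n) ℂ) (P : ℝ → Matrix (Fin n) ι ℂ)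
    (Q : ℝ → Matrix ι (Fin n) ℂ) (S : ℝ → Matrix (Fin n) (Fin n) ℂ) : Prop where
  P_eqn : HasAEDerivOn J P fun x => ∑ k, res A₁ (c k) * P x * q k x
  Q_eqn : HasAEDerivOn J Q fun x => -∑ k, q k x * Q x * res A₂ (c k)
  S_eqn : HasAEDerivOn J S fun x => -∑ k, res A₁ (c k) * P x * q k x * Q x * res A₂ (c k)

namespace IsSNodeFlow

theorem mono {I : Set ℝ} (h : IsSNodeFlow I c q A₁ A₂ P Q S) (hJI : J ⊆ I) :
    IsSNodeFlow J c q A₁ A₂ P Q S :=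
  ⟨h.P_eqn.mono hJI, h.Q_eqn.mono hJI, h.S_eqn.mono hJI⟩

theorem isSNode (hJ : J.OrdConnected) (h : IsSNodeFlow J c q A₁ A₂ P Q S)
    (hc₁ : ∀ k, c k ∉ spectrum ℂ A₁) (hc₂ : ∀ k, c k ∉ spectrum ℂ A₂) {a : ℝ} (ha : a ∈ J)
    (hnode : IsSNode A₁ A₂ (S a) (P a) (Q a)) {x : ℝ} (hx : x ∈ J) :
    IsSNode A₁ A₂ (S x) (P x) (Q x) := by
  refine HasAEDerivOn.eqOn hJ ((h.S_eqn.const_mul A₁).sub (h.S_eqn.mul_const A₂))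
    (h.P_eqn.mul h.Q_eqn) (fun x _ => ?_) ha hnode hx
  have hterm : ∀ k, A₁ * (res A₁ (c k) * P x * q k x * Q x * res A₂ (c k)) -
      res A₁ (c k) * P x * q k x * Q x * res A₂ (c k) * A₂ =
        P x * (q k x * Q x * res A₂ (c k)) - res A₁ (c k) * P x * q k x * Q x := by
    intro k
    set M := P x * q k x * Q x
    calc A₁ * (res A₁ (c k) * P x * q k x * Q x * res A₂ (c k)) -
          res A₁ (c k) * P x * q k x * Q x * res A₂ (c k) * A₂
        = A₁ * res A₁ (c k) * M * res A₂ (c k) - res A₁ (c k) * M * (res A₂ (c k) * A₂) := by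
          simp only [M, Matrix.mul_assoc]
      _ = M * res A₂ (c k) - res A₁ (c k) * M := by
          rw [mul_res (hc₁ k), res_mul (hc₂ k)]
          simp only [Matrix.add_mul, Matrix.mul_add, Matrix.one_mul, Matrix.mul_one,
            Matrix.smul_mul, Matrix.mul_smul]
          abel
      _ = _ := by simp only [M, Matrix.mul_assoc]
  have hsum := Finset.sum_congr rfl fun k (_ : k ∈ Finset.univ) => hterm k
  simp only [Finset.sum_sub_distrib, ← Matrix.mul_sum, ← Matrix.sum_mul] at hsum
  simp only [Matrix.mul_neg, Matrix.neg_mul]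
  rw [neg_sub_neg, ← neg_sub, hsum]
  abel

variable [DecidableEq ι]

theorem hasAEDerivOn_mul_inv (hJ : J.OrdConnected) (h : IsSNodeFlow J c q A₁ A₂ P Q S)
    (hS : ∀ x ∈ J, IsUnit (S x)) :
    HasAEDerivOn J (fun x => Q x * (S x)⁻¹) fun x =>
      -∑ k, nodeTransfer A₁ (S x) (P x) (Q x) (c k) * q k x * (Q x * res A₂ (c k) * (S x)⁻¹) := by
  refine (h.Q_eqn.mul (h.S_eqn.inv hJ hS)).congr_deriv fun x _ => ?_
  simp only [nodeTransfer, Matrix.sub_mul, Matrix.one_mul, Finset.sum_sub_distrib,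
    Matrix.neg_mul, Matrix.mul_neg, neg_neg, Matrix.sum_mul, Matrix.mul_sum, Matrix.mul_assoc]
  abel

theorem hasAEDerivOn_nodeTransfer (hJ : J.OrdConnected) (h : IsSNodeFlow J c q A₁ A₂ P Q S)
    (hS : ∀ x ∈ J, IsUnit (S x)) (z : ℂ) :
    HasAEDerivOn J (fun x => nodeTransfer A₁ (S x) (P x) (Q x) z) fun x =>
      -∑ k, (Q x * (S x)⁻¹ * res A₁ z * res A₁ (c k) * P x * q k x -
        nodeTransfer A₁ (S x) (P x) (Q x) (c k) * q k x *
          (Q x * res A₂ (c k) * (S x)⁻¹ * res A₁ z * P x)) := by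
  refine ((HasAEDerivOn.const J 1).sub
    (((h.hasAEDerivOn_mul_inv hJ hS).mul_const (res A₁ z)).mul h.P_eqn)).congr_deriv fun x _ => ?_
  simp only [Matrix.neg_mul, Matrix.sum_mul, Matrix.mul_sum, Finset.sum_sub_distrib,
    Matrix.mul_assoc]
  abel

theorem solvesDarbouxEq (hJ : J.OrdConnected) (h : IsSNodeFlow J c q A₁ A₂ P Q S)
    (hnode : ∀ x ∈ J, IsSNode A₁ A₂ (S x) (P x) (Q x)) (hS : ∀ x ∈ J, IsUnit (S x))
    (hc₁ : ∀ k, c k ∉ spectrum ℂ A₁) (hc₂ : ∀ k, c k ∉ spectrum ℂ A₂) (hzc : ∀ k, z ≠ c k)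
    (hz : z ∉ spectrum ℂ A₁) :
    SolvesDarbouxEq J (poleSystem c q z)
      (poleSystem c (fun k x => nodeCoeff A₁ A₂ (S x) (P x) (Q x) (c k) (q k x)) z)
      (fun x => nodeTransfer A₁ (S x) (P x) (Q x) z) := by
  refine (h.hasAEDerivOn_nodeTransfer hJ hS z).congr_deriv fun x hx => ?_
  have hterm : ∀ k, Q x * (S x)⁻¹ * res A₁ z * res A₁ (c k) * P x * q k x -
      nodeTransfer A₁ (S x) (P x) (Q x) (c k) * q k x *
        (Q x * res A₂ (c k) * (S x)⁻¹ * res A₁ z * P x) =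
      (z - c k)⁻¹ • (nodeCoeff A₁ A₂ (S x) (P x) (Q x) (c k) (q k x) *
        nodeTransfer A₁ (S x) (P x) (Q x) z - nodeTransfer A₁ (S x) (P x) (Q x) z * q k x) := by
    intro k
    rw [(hnode x hx).nodeCoeff_mul_nodeTransfer_sub (hS x hx) hz (hc₁ k) (hc₂ k),
      inv_smul_smul₀ (sub_ne_zero.2 (hzc k))]
  simp only [hterm, poleSystem, smul_sub, Finset.sum_sub_distrib, Matrix.neg_mul, Matrix.mul_neg,
    Matrix.sum_mul, Matrix.mul_sum, Matrix.smul_mul, Matrix.mul_smul]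
  abel

end IsSNodeFlow

end SNodeFlow

theorem SolvesDarbouxEq.isMatrixSolution_mul {ι : Type} [Fintype ι] {J : Set ℝ}
    {G G' W w : ℝ → Matrix ι ι ℂ} (hW : SolvesDarbouxEq J G G' W) (hw : IsMatrixSolution J G w) :
    IsMatrixSolution J G' (fun x => W x * w x) := by
  refine (HasAEDerivOn.mul hW hw).congr_deriv fun x _ => ?_
  rw [Matrix.sub_mul, Matrix.mul_assoc, Matrix.mul_assoc, add_sub_cancel]

theorem IsDarbouxMatrix.isFundamentalSolution_mul {ι : Type} [Fintype ι] [DecidableEq ι]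
    {J : Set ℝ} {G G' W w : ℝ → Matrix ι ι ℂ} (hW : IsDarbouxMatrix J G G' W)
    (hw : IsFundamentalSolution J G w) : IsFundamentalSolution J G' (fun x => W x * w x) :=
  ⟨hW.eqn.isMatrixSolution_mul hw.solution,
    fun x hx => (hW.nondegenerate x hx).mul (hw.invertible x hx)⟩

section Hamiltonian

variable {r m₁ m₂ p n : ℕ} {I J : Set ℝ} {c : Fin r → ℝ}
  {β : Fin r → ℝ → Matrix (Fin p) (Fin m₁ ⊕ Fin m₂) ℂ} {A S₀ : Matrix (Fin n) (Fin n) ℂ}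
  {P₀ : Matrix (Fin n) (Fin m₁ ⊕ Fin m₂) ℂ} {P : ℝ → Matrix (Fin n) (Fin m₁ ⊕ Fin m₂) ℂ}
  {S : ℝ → Matrix (Fin n) (Fin n) ℂ} {x : ℝ}

theorem sig_conjTranspose : (sig m₁ m₂)ᴴ = sig m₁ m₂ := by
  simp [sig, Matrix.fromBlocks_conjTranspose]

theorem sig_mul_sig : sig m₁ m₂ * sig m₁ m₂ = 1 := by
  simp [sig, Matrix.fromBlocks_multiply]

/-- The coefficient `qₖ = -i j βₖ^* βₖ` at the pole `cₖ` of a generalised Hamiltonian system. -/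
def hamPole (β : Fin r → ℝ → Matrix (Fin p) (Fin m₁ ⊕ Fin m₂) ℂ) (k : Fin r) (x : ℝ) :
    Matrix (Fin m₁ ⊕ Fin m₂) (Fin m₁ ⊕ Fin m₂) ℂ :=
  (-Complex.I) • (sig m₁ m₂ * ((β k x)ᴴ * β k x))

theorem hamCoeff_eq_poleSystem (z : ℂ) :
    hamCoeff c β z = poleSystem (fun k => (c k : ℂ)) (hamPole β) z := by
  funext x
  simp only [hamCoeff, poleSystem, hamPole, neg_smul, smul_neg, Finset.sum_neg_distrib, neg_neg,
    Finset.smul_sum, smul_comm Complex.I]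

theorem locSummableOn_hamPole (hI : I.OrdConnected)
    (hβ : ∀ k, LocSummableOn I (fun x => (β k x)ᴴ * β k x)) (k : Fin r) :
    LocSummableOn I (hamPole β k) := by
  have hmul := (hβ k).continuousOn_mul hI (continuousOn_const (c := (-Complex.I) • sig m₁ m₂))
  simp only [Matrix.smul_mul] at hmul
  exact hmul

/-- The second factor `Π₂^* = i j Π^*` of the symmetric S-node `A S - S A^* = i Π j Π^*`. -/
def hamDual (P : Matrix (Fin n) (Fin m₁ ⊕ Fin m₂) ℂ) : Matrix (Fin m₁ ⊕ Fin m₂) (Fin n) ℂ :=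
  Complex.I • (sig m₁ m₂ * Pᴴ)

theorem transfer_eq_nodeTransfer (z : ℂ) (x : ℝ) :
    transfer A P S z x = nodeTransfer A (S x) (P x) (hamDual (P x)) z := by
  simp only [transfer, nodeTransfer, hamDual, Matrix.smul_mul]

theorem sig_mul_conjTranspose_nodeTransfer_mul_sig {S : Matrix (Fin n) (Fin n) ℂ}
    {P : Matrix (Fin n) (Fin m₁ ⊕ Fin m₂) ℂ} (hS : Sᴴ = S) (z : ℂ) :
    sig m₁ m₂ * (nodeTransfer A S P (hamDual P) z)ᴴ * sig m₁ m₂ =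
      nodeCotransfer Aᴴ S P (hamDual P) (star z) := by
  simp only [nodeTransfer, nodeCotransfer, hamDual, Matrix.conjTranspose_sub,
    Matrix.conjTranspose_one, Matrix.conjTranspose_smul, Matrix.conjTranspose_mul,
    Matrix.conjTranspose_conjTranspose, Matrix.conjTranspose_nonsing_inv, hS, res_conjTranspose,
    sig_conjTranspose, Matrix.mul_add, Matrix.add_mul, Matrix.mul_one, Matrix.mul_smul,
    Matrix.smul_mul, Matrix.mul_assoc, sig_mul_sig, RCLike.star_def, Complex.conj_I, neg_smul,
    sub_neg_eq_add]

theorem gbdtCoeff_eq_hamPole (hS : (S x)ᴴ = S x) (k : Fin r) :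
    gbdtCoeff c β A P S k x = hamPole (betaT c β A P S) k x := by
  set T := nodeTransfer A (S x) (P x) (hamDual (P x)) (c k) with hT
  have hβT : (betaT c β A P S k x)ᴴ = sig m₁ m₂ * T * sig m₁ m₂ * (β k x)ᴴ := by
    simp only [betaT, transfer_eq_nodeTransfer, ← hT, Matrix.conjTranspose_mul,
      Matrix.conjTranspose_conjTranspose, sig_conjTranspose, Matrix.mul_assoc]
  have hcotransfer : nodeCotransfer Aᴴ (S x) (P x) (hamDual (P x)) (c k) =
      sig m₁ m₂ * Tᴴ * sig m₁ m₂ := by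
    rw [sig_mul_conjTranspose_nodeTransfer_mul_sig hS, RCLike.star_def, Complex.conj_ofReal]
  calc gbdtCoeff c β A P S k x
      = T * hamPole β k x * nodeCotransfer Aᴴ (S x) (P x) (hamDual (P x)) (c k) := nodeCoeff_eq _ _
    _ = (-Complex.I) • (sig m₁ m₂ * sig m₁ m₂ * T * sig m₁ m₂ * (β k x)ᴴ *
          (β k x * sig m₁ m₂ * Tᴴ * sig m₁ m₂)) := by
      simp only [hcotransfer, hamPole, sig_mul_sig, Matrix.one_mul, Matrix.mul_smul,
        Matrix.smul_mul, Matrix.mul_assoc]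
    _ = hamPole (betaT c β A P S) k x := by
      rw [hamPole, hβT, betaT, transfer_eq_nodeTransfer, ← hT]
      simp only [Matrix.mul_assoc]

theorem gbdtSystem_eq_hamCoeff (hS : (S x)ᴴ = S x) (z : ℂ) :
    gbdtSystem c β A P S z x = hamCoeff c (betaT c β A P S) z x := by
  simp only [hamCoeff_eq_poleSystem, gbdtSystem, poleSystem, gbdtCoeff_eq_hamPole hS]

namespace IsNodeFlow

theorem isSNodeFlow (h : IsNodeFlow I c β A S₀ P₀ P S) :
    IsSNodeFlow I (fun k => (c k : ℂ)) (hamPole β) A Aᴴ P (fun x => hamDual (P x)) S where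
  P_eqn := h.P_eqn.congr_deriv fun x _ => by
    simp only [hamPole, Finset.smul_sum, Matrix.mul_smul, Matrix.mul_assoc]
  Q_eqn := by
    have hQ := h.P_eqn.conjTranspose.const_mul (Complex.I • sig m₁ m₂)
    simp only [Matrix.smul_mul] at hQ
    refine hQ.congr_deriv fun x _ => ?_
    simp only [hamPole, hamDual, Matrix.conjTranspose_smul, Matrix.conjTranspose_sum,
      Matrix.conjTranspose_mul, Matrix.conjTranspose_conjTranspose, res_conjTranspose,
      sig_conjTranspose, RCLike.star_def, Complex.conj_ofReal, Matrix.mul_smul, Matrix.smul_mul,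
      Matrix.mul_sum, Finset.smul_sum, ← Finset.sum_neg_distrib, Matrix.mul_assoc]
    refine Finset.sum_congr rfl fun k _ => ?_
    simp
  S_eqn := h.S_eqn.congr_deriv fun x _ => by
    simp only [hamPole, hamDual, Matrix.mul_smul, Matrix.smul_mul, smul_smul, mul_neg,
      Complex.I_mul_I, neg_neg, one_smul, Matrix.mul_assoc]

theorem exists_isNodeFlow (hI : I.OrdConnected) (h0 : (0 : ℝ) ∈ I)
    (hβ : ∀ k, LocSummableOn I (fun x => (β k x)ᴴ * β k x)) :
    ∃ P S, IsNodeFlow I c β A S₀ P₀ P S := by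
  obtain ⟨P, hP0, hP⟩ := exists_hasAEDerivOn_twoSided (R := fun k => res A (c k)) hI
    (locSummableOn_hamPole hI hβ) h0 P₀
  have hS' : LocSummableOn I fun x => -∑ k, res A (c k) * P x * sig m₁ m₂ *
      ((β k x)ᴴ * β k x) * (sig m₁ m₂ * (P x)ᴴ * res Aᴴ (c k)) :=
    .neg <| .sum fun k => ((hβ k).continuousOn_mul hI
      ((hP.const_mul _).mul_const _).continuousOn).mul_continuousOn hI
        ((hP.conjTranspose.const_mul _).mul_const _).continuousOn
  obtain ⟨S, hS0, hS⟩ := hS'.exists_hasAEDerivOn hI h0 S₀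
  refine ⟨P, S, hP0, hS0, hP.congr_deriv fun x _ => ?_, hS.congr_deriv fun x _ => ?_⟩
  · simp only [hamPole, Finset.smul_sum, Matrix.mul_smul, Matrix.mul_assoc]
  · simp only [Matrix.mul_assoc]

theorem unique (hI : I.OrdConnected) (h0 : (0 : ℝ) ∈ I)
    (hβ : ∀ k, LocSummableOn I (fun x => (β k x)ᴴ * β k x))
    {P' : ℝ → Matrix (Fin n) (Fin m₁ ⊕ Fin m₂) ℂ} {S' : ℝ → Matrix (Fin n) (Fin n) ℂ}
    (h' : IsNodeFlow I c β A S₀ P₀ P' S') (h : IsNodeFlow I c β A S₀ P₀ P S) :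
    EqOn P' P I ∧ EqOn S' S I := by
  have hP : EqOn P' P I := eqOn_of_hasAEDerivOn_twoSided hI (locSummableOn_hamPole hI hβ) h0
    h'.isSNodeFlow.P_eqn h.isSNodeFlow.P_eqn (h'.P_zero.trans h.P_zero.symm)
  exact ⟨hP, h'.S_eqn.eqOn hI h.S_eqn (fun x hx => by rw [hP hx]) h0
    (h'.S_zero.trans h.S_zero.symm)⟩

theorem conjTranspose_eq (hI : I.OrdConnected) (h0 : (0 : ℝ) ∈ I) (hS₀ : S₀ᴴ = S₀)
    (h : IsNodeFlow I c β A S₀ P₀ P S) (hx : x ∈ I) : (S x)ᴴ = S x := by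
  refine h.S_eqn.conjTranspose.eqOn hI h.S_eqn (fun x _ => ?_) h0 (by rw [h.S_zero, hS₀]) hx
  simp only [Matrix.conjTranspose_neg, Matrix.conjTranspose_sum, Matrix.conjTranspose_mul,
    Matrix.conjTranspose_conjTranspose, res_conjTranspose, sig_conjTranspose, Matrix.mul_assoc,
    RCLike.star_def, Complex.conj_ofReal]

theorem isSNode (hI : I.OrdConnected) (h0 : (0 : ℝ) ∈ I) (hcA : ∀ k, (c k : ℂ) ∉ spectrum ℂ A)
    (hnode : A * S₀ - S₀ * Aᴴ = Complex.I • (P₀ * sig m₁ m₂ * P₀ᴴ))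
    (h : IsNodeFlow I c β A S₀ P₀ P S) (hx : x ∈ I) :
    IsSNode A Aᴴ (S x) (P x) (hamDual (P x)) := by
  refine h.isSNodeFlow.isSNode hI hcA (fun k => ?_) h0 ?_ hx
  · simpa using star_notMem_spectrum_conjTranspose (hcA k)
  · rw [IsSNode, h.S_zero, h.P_zero, hnode, hamDual, Matrix.mul_smul, Matrix.mul_assoc]

theorem locSummableOn_betaT (hJ : J.OrdConnected) (hJI : J ⊆ I)
    (hβ : ∀ k, LocSummableOn I (fun x => (β k x)ᴴ * β k x))
    (h : IsNodeFlow I c β A S₀ P₀ P S) (hS : ∀ x ∈ J, IsUnit (S x)) (k : Fin r) :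
    LocSummableOn J (fun x => (betaT c β A P S k x)ᴴ * betaT c β A P S k x) := by
  have hT := (h.isSNodeFlow.mono hJI).hasAEDerivOn_nodeTransfer hJ hS (c k)
  have hl := ((hT.const_mul (sig m₁ m₂)).mul_const (sig m₁ m₂)).continuousOn
  have hr := ((hT.conjTranspose.const_mul (sig m₁ m₂)).mul_const (sig m₁ m₂)).continuousOn
  simpa only [betaT, transfer_eq_nodeTransfer, Matrix.conjTranspose_mul,
    Matrix.conjTranspose_conjTranspose, sig_conjTranspose, Matrix.mul_assoc] using
    (((hβ k).mono hJI).continuousOn_mul hJ hl).mul_continuousOn hJ hr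

theorem solvesDarbouxEq_transfer (hI : I.OrdConnected) (h0 : (0 : ℝ) ∈ I)
    (hcA : ∀ k, (c k : ℂ) ∉ spectrum ℂ A)
    (hnode : A * S₀ - S₀ * Aᴴ = Complex.I • (P₀ * sig m₁ m₂ * P₀ᴴ)) (hJ : J.OrdConnected)
    (hJI : J ⊆ I) (h : IsNodeFlow I c β A S₀ P₀ P S) (hS : ∀ x ∈ J, IsUnit (S x)) {z : ℂ}
    (hzc : ∀ k, z ≠ c k) (hz : z ∉ spectrum ℂ A) :
    SolvesDarbouxEq J (hamCoeff c β z) (gbdtSystem c β A P S z) (transfer A P S z) := by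
  rw [hamCoeff_eq_poleSystem, funext (transfer_eq_nodeTransfer (S := S) z)]
  refine (h.isSNodeFlow.mono hJI).solvesDarbouxEq hJ
    (fun x hx => h.isSNode hI h0 hcA hnode (hJI hx)) hS hcA (fun k => ?_) hzc hz
  simpa using star_notMem_spectrum_conjTranspose (hcA k)

theorem isUnit_transfer (hI : I.OrdConnected) (h0 : (0 : ℝ) ∈ I)
    (hcA : ∀ k, (c k : ℂ) ∉ spectrum ℂ A)
    (hnode : A * S₀ - S₀ * Aᴴ = Complex.I • (P₀ * sig m₁ m₂ * P₀ᴴ))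
    (h : IsNodeFlow I c β A S₀ P₀ P S) (hx : x ∈ I) (hS : IsUnit (S x)) {z : ℂ}
    (hz : z ∉ spectrum ℂ A) (hz' : z ∉ spectrum ℂ Aᴴ) : IsUnit (transfer A P S z x) := by
  rw [transfer_eq_nodeTransfer]
  exact (h.isSNode hI h0 hcA hnode hx).isUnit_nodeTransfer hS hz hz'

end IsNodeFlow

end Hamiltonian

end GBDT

end

theorem theorem3p1 {r m₁ m₂ p n : ℕ}
    -- the interval on which the systems are considered
    (I : Set ℝ) (hI : I.OrdConnected) (h_zero : (0 : ℝ) ∈ I)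
    -- the initial generalised Hamiltonian system
    (c : Fin r → ℝ) (hc : Function.Injective c)
    (β : Fin r → ℝ → Matrix (Fin p) (Fin m₁ ⊕ Fin m₂) ℂ)
    (hβ : ∀ k, GBDT.LocSummableOn I (fun x => (β k x)ᴴ * β k x))
    -- the triple of matrices
    (A S₀ : Matrix (Fin n) (Fin n) ℂ) (P₀ : Matrix (Fin n) (Fin m₁ ⊕ Fin m₂) ℂ)
    (hcA : ∀ k, (c k : ℂ) ∉ spectrum ℂ A)
    (hnode : A * S₀ - S₀ * Aᴴ = Complex.I • (P₀ * GBDT.sig m₁ m₂ * P₀ᴴ))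
    (hS₀ : S₀ᴴ = S₀) :
    -- the matrix functions determined by the triple exist and are unique
    (∃ P S, GBDT.IsNodeFlow I c β A S₀ P₀ P S ∧
      ∀ P' S', GBDT.IsNodeFlow I c β A S₀ P₀ P' S' → Set.EqOn P' P I ∧ Set.EqOn S' S I) ∧
    ∀ P S, GBDT.IsNodeFlow I c β A S₀ P₀ P S →
      -- on every subinterval on which `S` is invertible
      ∀ J : Set ℝ, J.OrdConnected → J ⊆ I → (∀ x ∈ J, IsUnit (S x)) →
        -- the transformed Hamiltonians are locally summable
        (∀ k, GBDT.LocSummableOn J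
          (fun x => (GBDT.betaT c β A P S k x)ᴴ * GBDT.betaT c β A P S k x)) ∧
        -- the transformed system is the generalised Hamiltonian system of `β̃ₖ`
        (∀ k, ∀ x ∈ J, GBDT.gbdtCoeff c β A P S k x =
          (-Complex.I) • (GBDT.sig m₁ m₂ *
            ((GBDT.betaT c β A P S k x)ᴴ * GBDT.betaT c β A P S k x))) ∧
        (∀ z : ℂ, (∀ k, z ≠ c k) → ∀ x ∈ J, GBDT.gbdtSystem c β A P S z x =
          GBDT.hamCoeff c (GBDT.betaT c β A P S) z x) ∧
        -- the transfer function satisfies the Darboux equation and maps solutions to solutions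
        (∀ z : ℂ, (∀ k, z ≠ c k) → z ∉ spectrum ℂ A →
          GBDT.SolvesDarbouxEq J (GBDT.hamCoeff c β z)
            (GBDT.hamCoeff c (GBDT.betaT c β A P S) z) (GBDT.transfer A P S z) ∧
          ∀ w, GBDT.IsMatrixSolution J (GBDT.hamCoeff c β z) w →
            GBDT.IsMatrixSolution J (GBDT.hamCoeff c (GBDT.betaT c β A P S) z)
              (fun x => GBDT.transfer A P S z x * w x)) ∧
        -- it is a Darboux matrix and maps fundamental solutions to fundamental solutions
        (∀ z : ℂ, (∀ k, z ≠ c k) → z ∉ spectrum ℂ A → z ∉ spectrum ℂ Aᴴ →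
          GBDT.IsDarbouxMatrix J (GBDT.hamCoeff c β z)
            (GBDT.hamCoeff c (GBDT.betaT c β A P S) z) (GBDT.transfer A P S z) ∧
          ∀ w, GBDT.IsFundamentalSolution J (GBDT.hamCoeff c β z) w →
            GBDT.IsFundamentalSolution J (GBDT.hamCoeff c (GBDT.betaT c β A P S) z)
              (fun x => GBDT.transfer A P S z x * w x)) := by
  refine ⟨?_, fun P S h J hJ hJI hS => ?_⟩
  · obtain ⟨P, S, h⟩ := GBDT.IsNodeFlow.exists_isNodeFlow hI h_zero hβ
    exact ⟨P, S, h, fun _ _ h' => h'.unique hI h_zero hβ h⟩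
  have hSstar : ∀ x ∈ J, (S x)ᴴ = S x := fun x hx =>
    h.conjTranspose_eq hI h_zero hS₀ (hJI hx)
  have hdarboux : ∀ z : ℂ, (∀ k, z ≠ c k) → z ∉ spectrum ℂ A →
      GBDT.SolvesDarbouxEq J (GBDT.hamCoeff c β z) (GBDT.hamCoeff c (GBDT.betaT c β A P S) z)
        (GBDT.transfer A P S z) := fun z hzc hz =>
    (h.solvesDarbouxEq_transfer hI h_zero hcA hnode hJ hJI hS hzc hz).congr_deriv fun x hx => by
      rw [GBDT.gbdtSystem_eq_hamCoeff (hSstar x hx)]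
  have hinv : ∀ z : ℂ, z ∉ spectrum ℂ A → z ∉ spectrum ℂ Aᴴ →
      ∀ x ∈ J, IsUnit (GBDT.transfer A P S z x) := fun z hz hz' x hx =>
    h.isUnit_transfer hI h_zero hcA hnode (hJI hx) (hS x hx) hz hz'
  exact ⟨h.locSummableOn_betaT hJ hJI hβ hS,
    fun k x hx => GBDT.gbdtCoeff_eq_hamPole (hSstar x hx) k,
    fun z _ x hx => GBDT.gbdtSystem_eq_hamCoeff (hSstar x hx) z,
    fun z hzc hz => ⟨hdarboux z hzc hz, fun w => (hdarboux z hzc hz).isMatrixSolution_mul⟩,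
    fun z hzc hz hz' =>
      have hD := ⟨hdarboux z hzc hz, hinv z hz hz'⟩
      ⟨hD, fun w => GBDT.IsDarbouxMatrix.isFundamentalSolution_mul hD⟩⟩
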